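/- Let $D$ be a digraph; loops and parallel edges are allowed. A directed path is a finite sequence $x_0\ldots x_n$ ($n\ge 0$) of vertices with an edge from $x_i$ to $x_{i+1}$ for all $i<n$; its length is $n$. Let $d(x,y)\in\mathbb N\cup\{\infty\}$ be the length of a shortest directed path from $x$ to $y$, and for $r\ge 0$ put $\mathcal B^+_r(x)=\{y: d(x,y)\le r\}$ and $\mathcal B^-_r(x)=\{y: d(y,x)\le r\}$; for a set (or path) $S$ let $\mathcal B^\pm_r(S)=\bigcup_{s\in S}\mathcal B^\pm_r(s)$. The out-degree (in-degree) of $x$ is the number of vertices $y$ with $d(x,y)=1$ (with $d(y,x)=1$), and $D$ is locally finite if all in- and out-degrees are finite. A directed path from $x$ to $y$ is geodesic if its length is $d(x,y)$. $D$ is hyperbolic if there is $\delta\ge 0$ such that for all vertices $x,y,z$, every geodesic $P$ from $x$ to $y$, every geodesic $Q$ joining $x$ and $z$ (in either direction) and every geodesic $R$ joining $y$ and $z$ (in either direction), all vertices of $P$ lie in $\mathcal B^+_\delta(Q)\cup\mathcal B^-_\delta(R)$. Condition (B1), respectively (B2), says that there is a function $f$ such that for every vertex $x$, every $r\ge 0$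 and all $y,z\in\mathcal B^+_r(x)$, respectively all $y,z\in\mathcal B^-_r(x)$, either $d(y,z)=\infty$ or $d(y,z)\le f(r)$. A ray is a sequence $x_0x_1\ldots$ of distinct vertices with an edge from $x_i$ to $x_{i+1}$ for all $i$; an anti-ray is such a sequence with an edge from $x_{i+1}$ to $x_i$ for all $i$. A (anti-)ray is geodesic if all its finite directed subpaths are geodesic. For rays or anti-rays $R_1,R_2$ write $R_1\preccurlyeq R_2$ if there are infinitely many pairwise disjoint directed paths from $R_1$ to $R_2$, and $R_1\sim R_2$ if $R_1\preccurlyeq R_2\preccurlyeq R_1$. The classes of $\sim$ on all rays and anti-rays (on the rays, on the anti-rays) are the ends (f-ends, b-ends). For geodesic rays or anti-rays $R_1,R_2$ write $R_1\le R_2$ if there is $M\ge 0$ such that for every $r\ge 0$ and every vertex $x$ there is a directed path from $R_1$ to $R_2$ of length at most $M$ that avoids $\mathcal B^+_r(x)\cup\mathcal B^-_r(x)$, and $R_1\approx R_2$ if $R_1\le R_2\le R_1$. The classes of $\approx$ on all geodesic rays and anti-rays (on the geodesic rays, on the geodesic anti-rays) form the geodesic boundary (geodesic f-boundary, geodesic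 b-boundary). The geodesic boundary is a refinement of the ends if every geodesic boundary point is a subset of exactly one end and every end contains some geodesic boundary point as a subset; likewise for the f- and b-versions. **Proposition.** For every hyperbolic digraph $D$ that satisfies (B1) and (B2) the following hold. (i) If every vertex of $D$ has finite out-degree, then the geodesic f-boundary is a refinement of the f-ends. (ii) If every vertex of $D$ has finite in-degree, then the geodesic b-boundary is a refinement of the b-ends. (iii) If $D$ is locally finite, then the geodesic boundary is a refinement of the ends. -/

import Mathlib

open scoped NNReal ENNReal

/-!
Digraphs are quivers, so loops and parallel arrows are allowed.
A directed path is a `Quiver.Path`; its length is the number of its arrows.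
-/

namespace DigraphBoundary

section Distances

variable {V : Type*} [Quiver V]

/-- The distance from `x` to `y`: the length of a shortest directed path, `⊤` if there is none. -/
noncomputable def ddist (x y : V) : ℕ∞ :=
  ⨅ p : Quiver.Path x y, (p.length : ℕ∞)

/-- The out-ball of radius `r` around `x`. -/
def outBall (x : V) (r : ℝ≥0) : Set V :=
  {y | (ddist x y : ℝ≥0∞) ≤ r}

/-- The in-ball of radius `r` around `x`. -/
def inBall (x : V) (r : ℝ≥0) : Set V :=
  {y | (ddist y x : ℝ≥0∞) ≤ r}

/-- The out-ball of radius `r` around a set `S` of vertices. -/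
def outBallSet (S : Set V) (r : ℝ≥0) : Set V :=
  {y | ∃ x ∈ S, y ∈ outBall x r}

/-- The in-ball of radius `r` around a set `S` of vertices. -/
def inBallSet (S : Set V) (r : ℝ≥0) : Set V :=
  {y | ∃ x ∈ S, y ∈ inBall x r}

/-- A directed path is geodesic if its length is the distance between its end points. -/
def IsGeodesic {x y : V} (p : Quiver.Path x y) : Prop :=
  (p.length : ℕ∞) = ddist x y

/-- `S` is the vertex set of a geodesic joining `x` and `y`, in one of the two directions. -/
def IsGeodesicSide (x y : V) (S : Set V) : Prop :=
  (∃ p : Quiver.Path x y, IsGeodesic p ∧ S = {v | v ∈ p.vertices}) ∨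
  (∃ p : Quiver.Path y x, IsGeodesic p ∧ S = {v | v ∈ p.vertices})

/-- The set of out-neighbours of `x` different from `x`, whose size is the out-degree of `x`,
is finite. -/
def FiniteOutDegree (x : V) : Prop :=
  {y : V | ddist x y = 1}.Finite

/-- The set of in-neighbours of `x` different from `x`, whose size is the in-degree of `x`,
is finite. -/
def FiniteInDegree (x : V) : Prop :=
  {y : V | ddist y x = 1}.Finite

/-- There are infinitely many pairwise disjoint directed `A`-`B` paths. -/
def InfinitelyManyDisjointPaths (A B : Set V) : Prop :=
  ∃ (a b : ℕ → V) (p : ∀ n, Quiver.Path (a n) (b n)),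
    (∀ n, a n ∈ A ∧ b n ∈ B) ∧
    ∀ m n, m ≠ n → List.Disjoint (p m).vertices (p n).vertices

/-- For some `M`, there are directed `A`-`B` paths of length at most `M` outside of
all sets `outBall x r ∪ inBall x r`. -/
def BoundedPathsOutsideBalls (A B : Set V) : Prop :=
  ∃ M : ℝ≥0, ∀ (r : ℝ≥0) (x : V), ∃ a ∈ A, ∃ b ∈ B, ∃ p : Quiver.Path a b,
    (p.length : ℝ≥0) ≤ M ∧ ∀ v ∈ p.vertices, v ∉ outBall x r ∪ inBall x r

end Distances

section Hyperbolicity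

variable (V : Type*) [Quiver V]

/-- All geodesic triangles are `δ`-thin. In a triangle with corners `x`, `y`, `z`, the geodesic
`P` runs from `x` to `y`, and `Q` and `R` are the sides at its starting point and at its
end point; the directions of `Q` and `R` are arbitrary. -/
def IsDeltaHyperbolic (δ : ℝ≥0) : Prop :=
  ∀ (x y z : V) (P : Quiver.Path x y) (Q R : Set V), IsGeodesic P →
    IsGeodesicSide x z Q → IsGeodesicSide y z R →
    ∀ v ∈ P.vertices, v ∈ outBallSet Q δ ∪ inBallSet R δ

/-- The digraph is `δ`-hyperbolic for some `δ`. -/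
def IsHyperbolic : Prop :=
  ∃ δ : ℝ≥0, IsDeltaHyperbolic V δ

/-- Finite distances within out-balls of radius `r` are bounded in terms of `r`. -/
def BoundedOutBalls : Prop :=
  ∃ f : ℝ≥0 → ℝ≥0, ∀ (x : V) (r : ℝ≥0), ∀ y ∈ outBall x r, ∀ z ∈ outBall x r,
    ddist y z = ⊤ ∨ (ddist y z : ℝ≥0∞) ≤ f r

/-- Finite distances within in-balls of radius `r` are bounded in terms of `r`. -/
def BoundedInBalls : Prop :=
  ∃ f : ℝ≥0 → ℝ≥0, ∀ (x : V) (r : ℝ≥0), ∀ y ∈ inBall x r, ∀ z ∈ inBall x r,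
    ddist y z = ⊤ ∨ (ddist y z : ℝ≥0∞) ≤ f r

/-- Rays `x 0 → x 1 → ⋯` and anti-rays `⋯ → x 1 → x 0`, with distinct vertices. -/
inductive OneWayPath
  | ray (x : ℕ → V) (inj : Function.Injective x) (adj : ∀ i, Nonempty (x i ⟶ x (i + 1)))
  | antiRay (x : ℕ → V) (inj : Function.Injective x) (adj : ∀ i, Nonempty (x (i + 1) ⟶ x i))

end Hyperbolicity

namespace OneWayPath

variable {V : Type*} [Quiver V]

def IsRay : OneWayPath V → Prop
  | ray _ _ _ => True
  | antiRay _ _ _ => False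

def IsAntiRay : OneWayPath V → Prop
  | ray _ _ _ => False
  | antiRay _ _ _ => True

/-- The set of vertices of a ray or anti-ray. -/
def support : OneWayPath V → Set V
  | ray x _ _ => Set.range x
  | antiRay x _ _ => Set.range x

/-- A ray or anti-ray is geodesic if all its finite directed subpaths are. -/
def IsGeodesic : OneWayPath V → Prop
  | ray x _ _ => ∀ i j, i ≤ j → ddist (x i) (x j) = ((j - i : ℕ) : ℕ∞)
  | antiRay x _ _ => ∀ i j, i ≤ j → ddist (x j) (x i) = ((j - i : ℕ) : ℕ∞)

/-- The quasiorder whose equivalence classes are the geodesic boundary points. -/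
def GeodLE (R₁ R₂ : OneWayPath V) : Prop :=
  BoundedPathsOutsideBalls R₁.support R₂.support

/-- The quasiorder whose equivalence classes are the ends. -/
def EndLE (R₁ R₂ : OneWayPath V) : Prop :=
  InfinitelyManyDisjointPaths R₁.support R₂.support

end OneWayPath

/-- The classes of the relation `le a b ∧ le b a` on the set `s`. -/
def classesOn {α : Type*} (s : Set α) (le : α → α → Prop) : Set (Set α) :=
  {c | ∃ a ∈ s, c = {b | b ∈ s ∧ le a b ∧ le b a}}

/-- `𝒜` refines `ℬ`: every member of `𝒜` lies in exactly one member of `ℬ`, and every member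
of `ℬ` contains a member of `𝒜`. -/
def IsRefinement {α : Type*} (𝒜 ℬ : Set (Set α)) : Prop :=
  (∀ a ∈ 𝒜, ∃! b, b ∈ ℬ ∧ a ⊆ b) ∧ (∀ b ∈ ℬ, ∃ a ∈ 𝒜, a ⊆ b)

section Boundaries

variable (V : Type*) [Quiver V]

/-- The geodesic boundary. -/
def geodesicBoundary : Set (Set (OneWayPath V)) :=
  classesOn {R | R.IsGeodesic} OneWayPath.GeodLE

/-- The geodesic f-boundary. -/
def geodesicFBoundary : Set (Set (OneWayPath V)) :=
  classesOn {R | R.IsRay ∧ R.IsGeodesic} OneWayPath.GeodLE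

/-- The geodesic b-boundary. -/
def geodesicBBoundary : Set (Set (OneWayPath V)) :=
  classesOn {R | R.IsAntiRay ∧ R.IsGeodesic} OneWayPath.GeodLE

/-- The ends. -/
def ends : Set (Set (OneWayPath V)) :=
  classesOn Set.univ OneWayPath.EndLE

/-- The f-ends. -/
def fEnds : Set (Set (OneWayPath V)) :=
  classesOn {R | R.IsRay} OneWayPath.EndLE

/-- The b-ends. -/
def bEnds : Set (Set (OneWayPath V)) :=
  classesOn {R | R.IsAntiRay} OneWayPath.EndLE

end Boundaries

end DigraphBoundary

/-! The order on ends has a more flexible form: infinitely many disjoint paths exist exactly when no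
finite vertex set separates (`infinitelyManyDisjointPaths_iff`). In this form it is transitive, and
it follows from the order on the geodesic boundary (`GeodLE.endLE`). That order is reflexive on
geodesic rays and anti-rays, because (B1) and (B2) force them out of every ball
(`IsGeodesic.geodLE_refl`). So each geodesic boundary point lies in exactly one end, and it remains
to find a geodesic representative in every end.

Given a ray `x`, König's lemma yields a geodesic ray `y` from a vertex of `x` whose vertices each
lie on geodesics to infinitely many `x m`. Hence `y` cannot be finitely separated from `x`. For the
converse direction there are two cases. If some vertex of `x` can be reached from all of `x`, start
`y` there: a thin triangle through a geodesic back from `x m` gives paths to `y`, and (B1) keeps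
them away from a given finite set (`notFinitelySeparated_of_return`). Otherwise two thin triangles
and (B2) show that every `x n` reaches `y` (`exists_ddist_ne_top`), and a path from a late `x n`
that met the finite set would allow a forbidden return (`notFinitelySeparated_of_no_return`).
Anti-rays are handled by reversing all arrows. -/

namespace DigraphBoundary

/-! ### Finite vertex sets -/

section FiniteSets

theorem exists_bound_of_finite {V : Type*} {S : Set V} (hS : S.Finite) (g : V → ℕ∞) :
    ∃ k : ℕ, ∀ s ∈ S, g s ≠ ⊤ → g s ≤ k := by
  induction S, hS using Set.Finite.induction_on with
  | empty => exact ⟨0, by simp⟩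
  | @insert a S _ _ ih =>
    obtain ⟨k, hk⟩ := ih
    refine ⟨max k (g a).toNat, ?_⟩
    rintro s (rfl | hs) h
    · conv_lhs => rw [← ENat.natCast_toNat h]
      exact_mod_cast le_max_right _ _
    · exact (hk s hs h).trans (by exact_mod_cast le_max_left _ _)

theorem exists_forall_ge_notMem {V : Type*} {y : ℕ → V} (hy : Function.Injective y) {S : Set V}
    (hS : S.Finite) : ∃ N, ∀ i, N ≤ i → y i ∉ S := by
  obtain ⟨N, hN⟩ := (hS.preimage hy.injOn).bddAbove
  exact ⟨N + 1, fun i hi h => by have := hN h; omega⟩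

end FiniteSets

/-! ### Directed paths and segments of rays -/

section Paths

variable {V : Type*} [Quiver V]

theorem mem_vertices_comp {a b c : V} (p : Quiver.Path a b) (q : Quiver.Path b c) {v : V} :
    v ∈ (p.comp q).vertices ↔ v ∈ p.vertices ∨ v ∈ q.vertices := by
  induction q with
  | nil =>
    simp only [Quiver.Path.comp_nil, Quiver.Path.vertices_nil, List.mem_singleton]
    exact ⟨Or.inl, fun h => h.elim id fun h => h ▸ p.end_mem_vertices⟩
  | cons q e ih =>
    rw [Quiver.Path.comp_cons, Quiver.Path.mem_vertices_cons, Quiver.Path.mem_vertices_cons, ih,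
      or_assoc]

theorem exists_path_along {y : ℕ → V} (adj : ∀ i, Nonempty (y i ⟶ y (i + 1))) {i j : ℕ}
    (hij : i ≤ j) : ∃ p : Quiver.Path (y i) (y j), p.length = j - i ∧
      ∀ v, v ∈ p.vertices ↔ ∃ l, i ≤ l ∧ l ≤ j ∧ v = y l := by
  induction j, hij using Nat.le_induction with
  | base =>
    refine ⟨.nil, by simp, fun v => ?_⟩
    simp only [Quiver.Path.vertices_nil, List.mem_singleton]
    constructor
    · rintro rfl
      exact ⟨i, le_rfl, le_rfl, rfl⟩
    · rintro ⟨l, h, h', rfl⟩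
      rw [le_antisymm h h']
  | succ j hij ih =>
    obtain ⟨p, hp, hv⟩ := ih
    obtain ⟨e⟩ := adj j
    refine ⟨p.cons e, by rw [Quiver.Path.length_cons, hp]; omega, fun v => ?_⟩
    rw [Quiver.Path.mem_vertices_cons, hv]
    constructor
    · rintro (⟨l, h, h', rfl⟩ | rfl)
      · exact ⟨l, h, by omega, rfl⟩
      · exact ⟨j + 1, by omega, le_rfl, rfl⟩
    · rintro ⟨l, h, h', rfl⟩
      rcases h'.lt_or_eq with h' | rfl
      · exact .inl ⟨l, h, by omega, rfl⟩
      · exact .inr rfl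

end Paths

/-! ### Distances and points on geodesics -/

section Distances

variable {V : Type*} [Quiver V]

theorem ddist_le_length {x y : V} (p : Quiver.Path x y) : ddist x y ≤ p.length :=
  iInf_le _ p

theorem exists_isGeodesic {x y : V} (h : ddist x y ≠ ⊤) :
    ∃ p : Quiver.Path x y, IsGeodesic p := by
  have : Nonempty (Quiver.Path x y) := by
    by_contra hn
    rw [not_nonempty_iff] at hn
    exact h (iInf_of_empty _)
  obtain ⟨p, hp⟩ := ciInf_mem fun p : Quiver.Path x y => (p.length : ℕ∞)
  exact ⟨p, hp⟩

theorem ddist_ne_top {x y : V} (p : Quiver.Path x y) : ddist x y ≠ ⊤ :=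
  ne_top_of_le_ne_top (ENat.natCast_ne_top _) (ddist_le_length p)

theorem ddist_self (x : V) : ddist x x = 0 :=
  le_antisymm (ddist_le_length (.nil : Quiver.Path x x)) zero_le

theorem isGeodesic_nil (x : V) : IsGeodesic (.nil : Quiver.Path x x) :=
  (ddist_self x).symm

theorem ddist_triangle (x y z : V) : ddist x z ≤ ddist x y + ddist y z := by
  by_cases h : ddist x y = ⊤
  · simp [h]
  by_cases h' : ddist y z = ⊤
  · simp [h']
  obtain ⟨p, hp⟩ := exists_isGeodesic h
  obtain ⟨q, hq⟩ := exists_isGeodesic h'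
  rw [← hp, ← hq]
  exact (ddist_le_length (p.comp q)).trans (by simp)

theorem ddist_ne_top_trans {x y z : V} (h : ddist x y ≠ ⊤) (h' : ddist y z ≠ ⊤) :
    ddist x z ≠ ⊤ :=
  ne_top_of_le_ne_top (WithTop.add_ne_top.2 ⟨h, h'⟩) (ddist_triangle x y z)

/-- `v` lies on a geodesic from `x` to `y`. -/
def Between (x v y : V) : Prop :=
  ddist x y ≠ ⊤ ∧ ddist x y = ddist x v + ddist v y

theorem Between.left_ne_top {x v y : V} (h : Between x v y) : ddist x v ≠ ⊤ :=
  (WithTop.add_ne_top.1 (h.2 ▸ h.1)).1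

theorem Between.right_ne_top {x v y : V} (h : Between x v y) : ddist v y ≠ ⊤ :=
  (WithTop.add_ne_top.1 (h.2 ▸ h.1)).2

theorem IsGeodesic.between {x y v : V} {p : Quiver.Path x y} (hp : IsGeodesic p)
    (hv : v ∈ p.vertices) : Between x v y := by
  obtain ⟨q, r, rfl⟩ := p.exists_eq_comp_of_mem_vertices hv
  refine ⟨ddist_ne_top (q.comp r), le_antisymm (ddist_triangle _ _ _) ?_⟩
  rw [← hp, Quiver.Path.length_comp, Nat.cast_add]
  exact add_le_add (ddist_le_length q) (ddist_le_length r)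

theorem Between.isGeodesic_comp {x v y : V} (h : Between x v y) {p : Quiver.Path x v}
    {q : Quiver.Path v y} (hp : IsGeodesic p) (hq : IsGeodesic q) : IsGeodesic (p.comp q) := by
  rw [IsGeodesic, h.2, ← hp, ← hq, Quiver.Path.length_comp, Nat.cast_add]

theorem Between.trans_right {x v w y : V} (h : Between x v y) (h' : Between v w y) :
    Between x w y ∧ ddist x w = ddist x v + ddist v w := by
  have h1 := h.left_ne_top
  have h2 := h.right_ne_top
  have h3 := h'.left_ne_top
  have h4 := h'.right_ne_top
  have h5 := ddist_triangle x v w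
  have h6 := ddist_triangle x w y
  have h7 := h.2
  have h8 := h'.2
  have h9 := h.1
  have h10 : ddist x w ≠ ⊤ := ddist_ne_top_trans h1 h3
  have : ddist x w = ddist x v + ddist v w := by
    -- All distances here are finite, so the cancellation can be done in `ℕ`.
    generalize ddist x w = a at *
    generalize ddist x v = b at *
    generalize ddist v w = c at *
    generalize ddist w y = d at *
    generalize ddist x y = e at *
    generalize ddist v y = f at *
    lift a to ℕ using h10
    lift b to ℕ using h1
    lift c to ℕ using h3
    lift d to ℕ using h4
    lift e to ℕ using h9
    lift f to ℕ using h2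
    norm_cast at *
    omega
  refine ⟨⟨h9, ?_⟩, this⟩
  rw [h7, h8, this, add_assoc]

theorem Between.exists_next {x v y : V} (h : Between x v y) (hne : v ≠ y) :
    ∃ w, Nonempty (v ⟶ w) ∧ ddist v w = 1 ∧ Between x w y ∧ ddist x w = ddist x v + 1 := by
  obtain ⟨p, hp⟩ := exists_isGeodesic h.right_ne_top
  obtain ⟨n, hn⟩ : ∃ n, p.length = n + 1 :=
    Nat.exists_eq_succ_of_ne_zero fun h0 => hne (p.eq_of_length_zero h0)
  obtain ⟨w, e, q, hq, rfl⟩ := p.eq_toPath_comp_of_length_eq_succ hn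
  have hw := hp.between (v := w) ((mem_vertices_comp e.toPath q).2 (.inr q.start_mem_vertices))
  -- Distance zero would make `q` a shorter route from `v` to `y` than the geodesic.
  have h1 : ddist v w = 1 := by
    refine le_antisymm (ddist_le_length e.toPath) (Order.one_le_iff_ne_zero.2 fun h0 => ?_)
    have := hw.2
    rw [h0, ← hp, hn, zero_add] at this
    have := this.trans_le (ddist_le_length q)
    norm_cast at this
    omega
  obtain ⟨h2, h3⟩ := h.trans_right hw
  exact ⟨w, ⟨e⟩, h1, h2, by rw [h3, h1]⟩

end Distances

/-! ### Hyperbolicity and ball conditions with integer constants -/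

section NaturalRadii

theorem le_ceil_of_toENNReal_le {a : ℕ∞} {r : ℝ≥0} (h : (a : ℝ≥0∞) ≤ r) :
    a ≤ (⌈r⌉₊ : ℕ) := by
  rw [← ENat.toENNReal_le]
  refine h.trans ?_
  rw [ENat.toENNReal_coe]
  exact_mod_cast Nat.le_ceil r

theorem toENNReal_le_natCast {a : ℕ∞} {n : ℕ} (h : a ≤ n) : (a : ℝ≥0∞) ≤ ((n : ℝ≥0) : ℝ≥0∞) := by
  have := ENat.toENNReal_le.2 h
  rwa [ENat.toENNReal_coe] at this

variable {V : Type*} [Quiver V]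

theorem IsHyperbolic.exists_nat (h : IsHyperbolic V) :
    ∃ δ : ℕ, ∀ (x y z : V) (P : Quiver.Path x y) (Q R : Set V), IsGeodesic P →
      IsGeodesicSide x z Q → IsGeodesicSide y z R → ∀ v ∈ P.vertices,
        (∃ q ∈ Q, ddist q v ≤ δ) ∨ ∃ q ∈ R, ddist v q ≤ δ := by
  obtain ⟨δ, h⟩ := h
  refine ⟨⌈δ⌉₊, fun x y z P Q R hP hQ hR v hv => ?_⟩
  rcases h x y z P Q R hP hQ hR v hv with ⟨q, hq, h⟩ | ⟨q, hq, h⟩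
  · exact .inl ⟨q, hq, le_ceil_of_toENNReal_le h⟩
  · exact .inr ⟨q, hq, le_ceil_of_toENNReal_le h⟩

theorem BoundedOutBalls.exists_nat (h : BoundedOutBalls V) :
    ∃ f : ℕ → ℕ, ∀ (x y z : V) (r : ℕ), ddist x y ≤ r → ddist x z ≤ r → ddist y z ≠ ⊤ →
      ddist y z ≤ f r := by
  obtain ⟨f, h⟩ := h
  exact ⟨fun r => ⌈f r⌉₊, fun x y z r hy hz hyz => le_ceil_of_toENNReal_le
    ((h x r y (toENNReal_le_natCast hy) z (toENNReal_le_natCast hz)).resolve_left hyz)⟩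

theorem BoundedInBalls.exists_nat (h : BoundedInBalls V) :
    ∃ f : ℕ → ℕ, ∀ (x y z : V) (r : ℕ), ddist y x ≤ r → ddist z x ≤ r → ddist y z ≠ ⊤ →
      ddist y z ≤ f r := by
  obtain ⟨f, h⟩ := h
  exact ⟨fun r => ⌈f r⌉₊, fun x y z r hy hz hyz => le_ceil_of_toENNReal_le
    ((h x r y (toENNReal_le_natCast hy) z (toENNReal_le_natCast hz)).resolve_left hyz)⟩

end NaturalRadii

/-! ### Ends through finite separators -/

section Avoiding

variable {V : Type*} [Quiver V]

/-- No finite set of vertices meets all directed `A`-`B` paths. -/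
def NotFinitelySeparated (A B : Set V) : Prop :=
  ∀ S : Set V, S.Finite → ∃ a ∈ A, ∃ b ∈ B, ∃ p : Quiver.Path a b, ∀ v ∈ p.vertices, v ∉ S

/-- A finite set cannot meet infinitely many disjoint paths. Conversely, choose paths greedily, each
avoiding the finitely many vertices used before. -/
theorem infinitelyManyDisjointPaths_iff {A B : Set V} :
    InfinitelyManyDisjointPaths A B ↔ NotFinitelySeparated A B := by
  constructor
  · rintro ⟨a, b, p, hab, hp⟩ S hS
    by_contra! hn
    choose v hv hvS using fun n => hn (a n) (hab n).1 (b n) (hab n).2 (p n)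
    have : Function.Injective v := fun m n hmn => by
      by_contra hne
      exact hp m n hne (hv m) (hmn ▸ hv n)
    exact Set.infinite_of_injective_forall_mem this hvS hS
  · intro h
    obtain ⟨f, hf, hr⟩ := exists_seq_of_forall_finset_exists
      (fun x : Σ a b : V, Quiver.Path a b => x.1 ∈ A ∧ x.2.1 ∈ B)
      (fun x y => List.Disjoint x.2.2.vertices y.2.2.vertices) (fun s _ => by
        obtain ⟨a, ha, b, hb, p, hp⟩ := h (⋃ x ∈ s, {v | v ∈ x.2.2.vertices})
          (s.finite_toSet.biUnion fun x _ => List.finite_toSet _)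
        refine ⟨⟨a, b, p⟩, ⟨ha, hb⟩, fun x hx v hv hv' => hp v hv' ?_⟩
        exact Set.mem_biUnion hx hv)
    refine ⟨fun n => (f n).1, fun n => (f n).2.1, fun n => (f n).2.2, hf, fun m n hmn => ?_⟩
    rcases hmn.lt_or_gt with hlt | hlt
    · exact hr m n hlt
    · exact (hr n m hlt).symm

theorem NotFinitelySeparated.mono {A A' B B' : Set V} (h : NotFinitelySeparated A B)
    (hA : A ⊆ A') (hB : B ⊆ B') : NotFinitelySeparated A' B' := fun S hS => by
  obtain ⟨a, ha, b, hb, p⟩ := h S hS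
  exact ⟨a, hA ha, b, hB hb, p⟩

theorem NotFinitelySeparated.trans_ray {A B : Set V} {y : ℕ → V} (hy : Function.Injective y)
    (adj : ∀ i, Nonempty (y i ⟶ y (i + 1))) (h : NotFinitelySeparated A (Set.range y))
    (h' : NotFinitelySeparated (Set.range y) B) : NotFinitelySeparated A B := fun S hS => by
  obtain ⟨N, hN⟩ := exists_forall_ge_notMem hy hS
  -- Also forbidding initial segments of `y` makes `p` arrive after `S` has been left behind, and
  -- `q` depart no earlier than `p` arrives, so the ray itself links them.
  obtain ⟨a, ha, _, ⟨i, rfl⟩, p, hp⟩ := h (S ∪ y '' Set.Iio N) (hS.union ((Set.finite_Iio N).image y))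
  obtain ⟨_, ⟨j, rfl⟩, b, hb, q, hq⟩ := h' (S ∪ y '' Set.Iio i) (hS.union ((Set.finite_Iio i).image y))
  have hi : N ≤ i := by
    by_contra! hlt
    exact hp _ p.end_mem_vertices (.inr ⟨i, hlt, rfl⟩)
  have hj : i ≤ j := by
    by_contra! hlt
    exact hq _ q.start_mem_vertices (.inr ⟨j, hlt, rfl⟩)
  obtain ⟨w, -, hw⟩ := exists_path_along adj hj
  refine ⟨a, ha, b, hb, (p.comp w).comp q, fun v hv hvS => ?_⟩
  rw [mem_vertices_comp, mem_vertices_comp, hw] at hv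
  rcases hv with (hv | ⟨l, hl, -, rfl⟩) | hv
  · exact hp v hv (.inl hvS)
  · exact hN l (hi.trans hl) hvS
  · exact hq v hv (.inl hvS)

end Avoiding

/-! ### Reversing all arrows -/

section Reverse

open Opposite

variable {V : Type*} [Quiver V]

/-- A directed path as a directed path of the reversed digraph. -/
def opPath {a : V} : ∀ {b : V}, Quiver.Path a b → Quiver.Path (op b) (op a)
  | _, .nil => .nil
  | _, .cons p e => e.op.toPath.comp (opPath p)

/-- A directed path of the reversed digraph as a directed path. -/
def unopPath {a : Vᵒᵖ} : ∀ {b : Vᵒᵖ}, Quiver.Path a b → Quiver.Path (unop b) (unop a)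
  | _, .nil => .nil
  | _, .cons p e => e.unop.toPath.comp (unopPath p)

theorem length_opPath {a b : V} (p : Quiver.Path a b) : (opPath p).length = p.length := by
  induction p with
  | nil => rfl
  | cons p e ih =>
    rw [opPath, Quiver.Path.length_comp, ih, Quiver.Path.length_cons, add_comm]
    rfl

theorem length_unopPath {a b : Vᵒᵖ} (p : Quiver.Path a b) : (unopPath p).length = p.length := by
  induction p with
  | nil => rfl
  | cons p e ih =>
    rw [unopPath, Quiver.Path.length_comp, ih, Quiver.Path.length_cons, add_comm]
    rfl

theorem mem_vertices_opPath {a b : V} (p : Quiver.Path a b) {v : Vᵒᵖ} :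
    v ∈ (opPath p).vertices ↔ unop v ∈ p.vertices := by
  induction p with
  | nil => simp [opPath, ← unop_inj_iff]
  | cons p e ih =>
    have := p.end_mem_vertices
    rw [opPath, mem_vertices_comp, ih, Quiver.Path.mem_vertices_cons, Quiver.Path.vertices_toPath]
    simp only [List.mem_cons, List.not_mem_nil, or_false, ← unop_inj_iff]
    grind

theorem mem_vertices_unopPath {a b : Vᵒᵖ} (p : Quiver.Path a b) {v : V} :
    v ∈ (unopPath p).vertices ↔ op v ∈ p.vertices := by
  induction p with
  | nil => simp [unopPath, ← unop_inj_iff]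
  | cons p e ih =>
    have := p.end_mem_vertices
    rw [unopPath, mem_vertices_comp, ih, Quiver.Path.mem_vertices_cons,
      Quiver.Path.vertices_toPath]
    have h (w : Vᵒᵖ) : v = unop w ↔ op v = w := ⟨congrArg op, congrArg unop⟩
    simp only [List.mem_cons, List.not_mem_nil, or_false, h]
    grind

theorem ddist_op (x y : V) : ddist (op x) (op y) = ddist y x := by
  refine le_antisymm (le_iInf fun p => ?_) (le_iInf fun p => ?_)
  · rw [← length_opPath]
    exact ddist_le_length _
  · rw [← length_unopPath]
    exact ddist_le_length (unopPath p)

theorem ddist_unop (x y : Vᵒᵖ) : ddist (unop x) (unop y) = ddist y x :=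
  (ddist_op _ _).symm

theorem isGeodesic_unopPath {x y : Vᵒᵖ} {p : Quiver.Path x y} (hp : IsGeodesic p) :
    IsGeodesic (unopPath p) := by
  rw [IsGeodesic, length_unopPath, hp]
  exact ddist_op x.unop y.unop

theorem IsGeodesicSide.unop {x y : Vᵒᵖ} {S : Set Vᵒᵖ} (h : IsGeodesicSide x y S) :
    IsGeodesicSide x.unop y.unop (op ⁻¹' S) := by
  rcases h with ⟨p, hp, rfl⟩ | ⟨p, hp, rfl⟩
  · exact .inr ⟨unopPath p, isGeodesic_unopPath hp,
      Set.ext fun v => (mem_vertices_unopPath p).symm⟩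
  · exact .inl ⟨unopPath p, isGeodesic_unopPath hp,
      Set.ext fun v => (mem_vertices_unopPath p).symm⟩

theorem mem_outBall_op {x y : Vᵒᵖ} {r : ℝ≥0} : y ∈ outBall x r ↔ y.unop ∈ inBall x.unop r := by
  rw [outBall, inBall, Set.mem_ofPred_eq, Set.mem_ofPred_eq]
  exact iff_of_eq (congrArg (fun d : ℕ∞ => (d : ℝ≥0∞) ≤ r) (ddist_op x.unop y.unop))

theorem mem_inBall_op {x y : Vᵒᵖ} {r : ℝ≥0} : y ∈ inBall x r ↔ y.unop ∈ outBall x.unop r := by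
  rw [outBall, inBall, Set.mem_ofPred_eq, Set.mem_ofPred_eq]
  exact iff_of_eq (congrArg (fun d : ℕ∞ => (d : ℝ≥0∞) ≤ r) (ddist_op y.unop x.unop))

/-- Reversal exchanges the ends of `P`, hence the roles of `Q` and `R`, and also exchanges out-balls
with in-balls; thinness is invariant under both together. -/
theorem IsHyperbolic.op (h : IsHyperbolic V) : IsHyperbolic Vᵒᵖ := by
  obtain ⟨δ, h⟩ := h
  refine ⟨δ, fun x y z P Q R hP hQ hR v hv => ?_⟩
  rcases h y.unop x.unop z.unop (unopPath P) _ _ (isGeodesic_unopPath hP) hR.unop hQ.unop v.unop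
    ((mem_vertices_unopPath P).2 hv) with ⟨q, hq, h⟩ | ⟨q, hq, h⟩
  · exact .inr ⟨Opposite.op q, hq, mem_inBall_op.2 h⟩
  · exact .inl ⟨Opposite.op q, hq, mem_outBall_op.2 h⟩

theorem BoundedInBalls.op (h : BoundedInBalls V) : BoundedOutBalls Vᵒᵖ := by
  obtain ⟨f, h⟩ := h
  refine ⟨f, fun x r y hy z hz => ?_⟩
  rw [← ddist_unop]
  exact h x.unop r _ (mem_outBall_op.1 hz) _ (mem_outBall_op.1 hy)

theorem BoundedOutBalls.op (h : BoundedOutBalls V) : BoundedInBalls Vᵒᵖ := by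
  obtain ⟨f, h⟩ := h
  refine ⟨f, fun x r y hy z hz => ?_⟩
  rw [← ddist_unop]
  exact h x.unop r _ (mem_inBall_op.1 hz) _ (mem_inBall_op.1 hy)

theorem FiniteInDegree.op {x : V} (h : FiniteInDegree x) : FiniteOutDegree (op x) :=
  (h.image Opposite.op).subset fun y hy => ⟨y.unop, (ddist_unop y (Opposite.op x)).trans hy, rfl⟩

theorem notFinitelySeparated_op {A B : Set V} :
    NotFinitelySeparated (unop ⁻¹' A) (unop ⁻¹' B) ↔ NotFinitelySeparated B A := by
  refine ⟨fun h S hS => ?_, fun h S hS => ?_⟩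
  · obtain ⟨a, ha, b, hb, p, hp⟩ := h (unop ⁻¹' S) (hS.preimage unop_injective.injOn)
    exact ⟨_, hb, _, ha, unopPath p, fun v hv => hp _ ((mem_vertices_unopPath p).1 hv)⟩
  · obtain ⟨a, ha, b, hb, p, hp⟩ := h (Opposite.op ⁻¹' S) (hS.preimage op_injective.injOn)
    exact ⟨Opposite.op b, hb, Opposite.op a, ha, opPath p,
      fun v hv => hp _ ((mem_vertices_opPath p).1 hv)⟩

theorem unop_preimage_range {V : Type*} (y : ℕ → V) :
    unop ⁻¹' Set.range y = Set.range fun i => op (y i) :=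
  Set.ext fun _ => ⟨fun ⟨i, hi⟩ => ⟨i, congrArg op hi⟩, fun ⟨i, hi⟩ => ⟨i, congrArg unop hi⟩⟩

theorem NotFinitelySeparated.trans_antiRay {A B : Set V} {y : ℕ → V} (hy : Function.Injective y)
    (adj : ∀ i, Nonempty (y (i + 1) ⟶ y i)) (h : NotFinitelySeparated A (Set.range y))
    (h' : NotFinitelySeparated (Set.range y) B) : NotFinitelySeparated A B := by
  rw [← notFinitelySeparated_op] at h h' ⊢
  rw [unop_preimage_range] at h h'
  exact h'.trans_ray (op_injective.comp hy) (fun i => (adj i).map Quiver.Hom.op) h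

end Reverse


/-! ### Geodesic rays equivalent to a given ray -/

section GeodesicRays

variable {V : Type*} [Quiver V]

/-- The pigeonhole step of König's lemma: infinitely many geodesics through `v` continue to only
finitely many next vertices. -/
theorem exists_next_of_infinite (hfin : ∀ v : V, FiniteOutDegree v) {x : ℕ → V}
    (hx : Function.Injective x) {o v : V} (h : {m | Between o v (x m)}.Infinite) :
    ∃ w, Nonempty (v ⟶ w) ∧ ddist o w = ddist o v + 1 ∧ {m | Between o w (x m)}.Infinite := by
  have hv : (x ⁻¹' {v}).Finite := (Set.finite_singleton v).preimage hx.injOn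
  -- Where `x m = v` the geodesic ends at `v` and has no next vertex.
  have h' := h.sdiff hv
  by_contra! hcon
  refine h' (Set.Finite.subset ((hfin v).biUnion
    (t := fun w => {m | Nonempty (v ⟶ w) ∧ ddist o w = ddist o v + 1 ∧ Between o w (x m)})
    fun w _ => ?_) ?_)
  · by_cases hw : Nonempty (v ⟶ w) ∧ ddist o w = ddist o v + 1
    · exact (hcon w hw.1 hw.2).subset fun m hm => hm.2.2
    · exact Set.finite_empty.subset fun m hm => hw ⟨hm.1, hm.2.1⟩
  · rintro m ⟨hm, hne⟩
    obtain ⟨w, h1, h2, h3, h4⟩ := Between.exists_next hm fun h => hne h.symm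
    exact Set.mem_biUnion (show w ∈ {w | ddist v w = 1} from h2) ⟨h1, h4, h3⟩

theorem exists_geodesic_ray (hfin : ∀ v : V, FiniteOutDegree v) {x : ℕ → V}
    (hx : Function.Injective x) {o : V} (ho : ∀ m, ddist o (x m) ≠ ⊤) :
    ∃ y : ℕ → V, y 0 = o ∧ (∀ i, Nonempty (y i ⟶ y (i + 1))) ∧ (∀ i, ddist o (y i) = i) ∧
      ∀ k, {m | Between o (y k) (x m)}.Infinite := by
  have h0 : {m | Between o o (x m)}.Infinite := by
    convert Set.infinite_univ (α := ℕ)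
    exact Set.eq_univ_of_forall fun m => ⟨ho m, by rw [ddist_self, zero_add]⟩
  choose f hf using fun v : {v : V // {m | Between o v (x m)}.Infinite} =>
    exists_next_of_infinite hfin hx v.2
  let y : ℕ → {v : V // {m | Between o v (x m)}.Infinite} :=
    fun n => Nat.rec ⟨o, h0⟩ (fun _ v => ⟨f v, (hf v).2.2⟩) n
  refine ⟨fun i => (y i).1, rfl, fun i => (hf (y i)).1, fun i => ?_, fun k => (y k).2⟩
  induction i with
  | zero => exact ddist_self o
  | succ i ih =>
    have := (hf (y i)).2.1
    rw [ih] at this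
    exact_mod_cast this

theorem ddist_eq_sub {y : ℕ → V} (adj : ∀ i, Nonempty (y i ⟶ y (i + 1)))
    (hy : ∀ i, ddist (y 0) (y i) = i) {i j : ℕ} (hij : i ≤ j) :
    ddist (y i) (y j) = ((j - i : ℕ) : ℕ∞) := by
  obtain ⟨p, hp, -⟩ := exists_path_along adj hij
  have h1 := ddist_le_length p
  have h2 := ddist_triangle (y 0) (y i) (y j)
  rw [hp] at h1
  rw [hy, hy] at h2
  have h3 := ddist_ne_top p
  generalize ddist (y i) (y j) = d at *
  lift d to ℕ using h3
  norm_cast at *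
  omega

theorem injective_of_ddist {y : ℕ → V} (hy : ∀ i, ddist (y 0) (y i) = i) :
    Function.Injective y := fun i j hij => by
  have := (hy i).symm.trans (hij ▸ hy j)
  exact_mod_cast this

/-- Continuing a geodesic beyond `y (k + 1)` only increases the distance from `y 0`, so it misses
every vertex of `S` once `k` bounds their finite distances from `y 0`. -/
theorem notFinitelySeparated_of_between {x y : ℕ → V} (hy : ∀ i, ddist (y 0) (y i) = i)
    (hxy : ∀ k, {m | Between (y 0) (y k) (x m)}.Infinite) :
    NotFinitelySeparated (Set.range y) (Set.range x) := fun S hS => by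
  obtain ⟨k, hk⟩ := exists_bound_of_finite hS (ddist (y 0))
  obtain ⟨m, hm⟩ := (hxy (k + 1)).nonempty
  obtain ⟨p, hp⟩ := exists_isGeodesic hm.right_ne_top
  refine ⟨_, ⟨k + 1, rfl⟩, _, ⟨m, rfl⟩, p, fun v hv hvS => ?_⟩
  obtain ⟨h1, h2⟩ := hm.trans_right (hp.between hv)
  have h3 := hk v hvS h1.left_ne_top
  rw [h2, hy] at h3
  have h4 : ((k + 1 : ℕ) : ℕ∞) ≤ k := le_self_add.trans h3
  norm_cast at h4
  omega

theorem notFinitelySeparated_of_return (hyp : IsHyperbolic V) (hB1 : BoundedOutBalls V)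
    {x y : ℕ → V} (adjy : ∀ i, Nonempty (y i ⟶ y (i + 1))) (hy : ∀ i, ddist (y 0) (y i) = i)
    (hxy : ∀ k, {m | Between (y 0) (y k) (x m)}.Infinite)
    (hback : ∀ m, ddist (x m) (y 0) ≠ ⊤) :
    NotFinitelySeparated (Set.range x) (Set.range y) := fun S hS => by
  obtain ⟨δ, hδ⟩ := hyp.exists_nat
  obtain ⟨f, hf⟩ := hB1.exists_nat
  obtain ⟨k₀, hk₀⟩ := exists_bound_of_finite hS (ddist (y 0))
  obtain ⟨t, ht⟩ := exists_bound_of_finite hS (fun s => ddist s (y 0))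
  -- The summand `k₀ + δ` keeps the final stretch into `y k` off `S`; the (B1) bound does so for the
  -- stretch along `G`. Passing through `y (k + δ + 1)` makes `y k` more than `δ` from `x m`.
  obtain ⟨k, hk⟩ : ∃ k, k = k₀ + δ + f (max t δ) + 1 := ⟨_, rfl⟩
  obtain ⟨m, hm⟩ := (hxy (k + δ + 1)).nonempty
  have hym : ddist (y k) (x m) = (δ + 1 : ℕ) + ddist (y (k + δ + 1)) (x m) ∧
      Between (y 0) (y k) (x m) := by
    have h1 := ddist_triangle (y k) (y (k + δ + 1)) (x m)
    have h2 := ddist_triangle (y 0) (y k) (x m)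
    have h3 := hm.2
    have h4 := hm.right_ne_top
    have h5 := hm.1
    have h6 : ddist (y k) (x m) ≠ ⊤ := ddist_ne_top_trans
      (by rw [ddist_eq_sub adjy hy (show k ≤ k + δ + 1 by omega)]; exact ENat.natCast_ne_top _) h4
    rw [ddist_eq_sub adjy hy (by omega)] at h1
    rw [hy] at h2 h3
    rw [Between, hy]
    generalize ddist (y k) (x m) = a at *
    generalize ddist (y (k + δ + 1)) (x m) = b at *
    generalize ddist (y 0) (x m) = c at *
    lift a to ℕ using h6
    lift b to ℕ using h4
    lift c to ℕ using h5
    refine ⟨?_, ENat.natCast_ne_top _, ?_⟩ <;> norm_cast at * <;> omega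
  obtain ⟨hym, hbt⟩ := hym
  obtain ⟨p, hp⟩ := exists_isGeodesic hbt.left_ne_top
  obtain ⟨p', hp'⟩ := exists_isGeodesic hbt.right_ne_top
  obtain ⟨G, hG⟩ := exists_isGeodesic (hback m)
  have hgeo := hbt.isGeodesic_comp hp hp'
  -- A degenerate triangle: the third corner is `x m` again, with a trivial side.
  rcases hδ _ _ (x m) _ {v | v ∈ G.vertices} {v | v ∈ (Quiver.Path.nil : Quiver.Path (x m) _).vertices}
      hgeo (.inr ⟨G, hG, rfl⟩) (.inl ⟨_, isGeodesic_nil _, rfl⟩) (y k)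
      ((mem_vertices_comp _ _).2 (.inl p.end_mem_vertices)) with ⟨g, hg, hgy⟩ | ⟨g, hg, hgy⟩
  · have hgb := hG.between hg
    have hgy' : ddist g (y k) ≠ ⊤ := ne_top_of_le_ne_top (ENat.natCast_ne_top _) hgy
    obtain ⟨p₁, hp₁⟩ := exists_isGeodesic hgb.left_ne_top
    obtain ⟨p₂, hp₂⟩ := exists_isGeodesic hgy'
    refine ⟨_, ⟨m, rfl⟩, _, ⟨k, rfl⟩, p₁.comp p₂, fun v hv hvS => ?_⟩
    rcases (mem_vertices_comp _ _).1 hv with hv | hv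
    · have hvg := hp₁.between hv
      have hv0 : ddist v (y 0) ≠ ⊤ := ddist_ne_top_trans hvg.right_ne_top hgb.right_ne_top
      -- On the geodesic `G` towards `y 0`, the vertex `v` comes before `g`. Then `y 0` and `y k`
      -- share a small out-ball around `g`, too small for their distance `k`.
      have h1 : ddist g (y 0) ≤ t := by
        refine le_trans ?_ (ht v hvS hv0)
        have h2 := ddist_triangle (x m) v (y 0)
        rw [hgb.2, hvg.2, add_assoc] at h2
        exact le_add_self.trans ((ENat.add_le_add_iff_left hvg.left_ne_top).1 h2)
      have h3 := hf g (y 0) (y k) (max t δ) (h1.trans (by exact_mod_cast le_max_left _ _))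
        (hgy.trans (by exact_mod_cast le_max_right _ _)) hbt.left_ne_top
      rw [hy] at h3
      norm_cast at h3
      omega
    · have hvy := hp₂.between hv
      have hv0 : ddist (y 0) v ≠ ⊤ :=
        ddist_ne_top_trans (ddist_ne_top_trans hbt.1 hgb.left_ne_top) hvy.left_ne_top
      have h1 : ddist v (y k) ≤ δ := by
        refine le_trans ?_ hgy
        rw [hvy.2]
        exact le_add_self
      have h2 := (ddist_triangle (y 0) v (y k)).trans (add_le_add (hk₀ v hvS hv0) h1)
      rw [hy] at h2
      norm_cast at h2
      omega
  · have : g = x m := by simpa using hg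
    rw [this, hym] at hgy
    have := le_self_add.trans hgy
    norm_cast at this
    omega

theorem exists_ddist_ne_top (hyp : IsHyperbolic V) (hB2 : BoundedInBalls V) {x y : ℕ → V}
    (adjx : ∀ i, Nonempty (x i ⟶ x (i + 1))) (adjy : ∀ i, Nonempty (y i ⟶ y (i + 1)))
    (hy : ∀ i, ddist (y 0) (y i) = i) (hxy : ∀ k, {m | Between (y 0) (y k) (x m)}.Infinite)
    (n : ℕ) (hn : ddist (y 0) (x n) ≠ ⊤) : ∃ j, ddist (x n) (y j) ≠ ⊤ := by
  obtain ⟨δ, hδ⟩ := hyp.exists_nat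
  obtain ⟨f, hf⟩ := hB2.exists_nat
  obtain ⟨L, hL⟩ := ENat.ne_top_iff_exists.1 hn
  -- `k` exceeds `L + δ`, so `y k` is not near `Pn`, and exceeds the (B2) bound for radius `L + δ`.
  -- `K` leaves room for two `δ`-steps after `y k` without getting beyond `y K`.
  obtain ⟨k, hk⟩ : ∃ k, k = f (L + δ) + L + δ + 1 := ⟨_, rfl⟩
  obtain ⟨K, hK⟩ : ∃ K, K = k + 2 * δ + 1 := ⟨_, rfl⟩
  obtain ⟨m, hm, hnm⟩ := (hxy K).exists_gt n
  obtain ⟨P₁, hP₁, hvP₁⟩ := exists_path_along adjy (Nat.zero_le K)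
  obtain ⟨P₂, hP₂⟩ := exists_isGeodesic hm.right_ne_top
  have hP := hm.isGeodesic_comp (show IsGeodesic P₁ by rw [IsGeodesic, hP₁, hy]; rfl) hP₂
  obtain ⟨Pn, hPn⟩ := exists_isGeodesic hn
  obtain ⟨w, -, -⟩ := exists_path_along adjx hnm.le
  obtain ⟨Q, hQ⟩ := exists_isGeodesic (ddist_ne_top w)
  have far : ∀ p ∈ Pn.vertices, ∀ v, ddist p v ≤ δ → ddist (y 0) v ≤ (L + δ : ℕ) := by
    intro p hp v hv
    have h1 : ddist (y 0) p ≤ L := by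
      rw [hL, (hPn.between hp).2]
      exact le_self_add
    exact (ddist_triangle (y 0) p v).trans (by push_cast; exact add_le_add h1 hv)
  rcases hδ _ _ (x n) _ _ _ hP (.inl ⟨Pn, hPn, rfl⟩) (.inr ⟨Q, hQ, rfl⟩) (y k)
      ((mem_vertices_comp _ _).2 (.inl ((hvP₁ _).2 ⟨k, by omega, by omega, rfl⟩)))
      with ⟨p, hp, hpy⟩ | ⟨q, hq, hyq⟩
  · have := far p hp _ hpy
    rw [hy] at this
    norm_cast at this
    omega
  have hyq' : ddist (y k) q ≠ ⊤ := ne_top_of_le_ne_top (ENat.natCast_ne_top _) hyq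
  -- The same triangle with `Q` as its distinguished side. If `q` is near `Pn`, then `y 0` and `y k`
  -- lie in one in-ball of `q`, contradicting (B2). Otherwise `q` leads to the main geodesic, and
  -- the choice of `K` puts the landing point on `y`.
  rcases hδ _ _ (y 0) _ _ _ hQ (.inr ⟨Pn, hPn, rfl⟩) (.inr ⟨_, hP, rfl⟩) q hq
      with ⟨p, hp, hpq⟩ | ⟨p, hp, hqp⟩
  · have h1 := hf q (y 0) (y k) (L + δ) (far p hp q hpq)
      (hyq.trans (by exact_mod_cast Nat.le_add_left _ _))
      (by rw [hy]; exact ENat.natCast_ne_top _)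
    rw [hy] at h1
    norm_cast at h1
    omega
  · have hqp' : ddist q p ≠ ⊤ := ne_top_of_le_ne_top (ENat.natCast_ne_top _) hqp
    rcases (mem_vertices_comp _ _).1 hp with hp | hp
    · obtain ⟨l, -, -, rfl⟩ := (hvP₁ _).1 hp
      exact ⟨l, ddist_ne_top_trans (hQ.between hq).left_ne_top hqp'⟩
    · have h1 := (hm.trans_right (hP₂.between hp)).2
      have h2 : ddist (y 0) p ≤ (k + 2 * δ : ℕ) := by
        refine (ddist_triangle (y 0) (y k) p).trans ?_
        refine (add_le_add_right (ddist_triangle (y k) q p) _).trans ?_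
        refine (add_le_add_right (add_le_add hyq hqp) _).trans ?_
        rw [hy]
        norm_cast
        omega
      rw [h1, hy] at h2
      have := le_self_add.trans h2
      norm_cast at this
      omega

theorem notFinitelySeparated_of_no_return {x y : ℕ → V}
    (hxy : ∀ j, ∃ m, ddist (y j) (x m) ≠ ⊤)
    (adjx : ∀ i, Nonempty (x i ⟶ x (i + 1))) (hyx : ∀ n, ∃ j, ddist (x n) (y j) ≠ ⊤)
    (hno : ∀ N, ∃ n, ddist (x n) (x N) = ⊤) :
    NotFinitelySeparated (Set.range x) (Set.range y) := fun S hS => by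
  have mono : ∀ {v m n}, m ≤ n → ddist v (x m) ≠ ⊤ → ddist v (x n) ≠ ⊤ := fun hmn h => by
    obtain ⟨w, -, -⟩ := exists_path_along adjx hmn
    exact ddist_ne_top_trans h (ddist_ne_top w)
  -- Reaching `x m` implies reaching all later vertices, so one index serves all of `S`.
  obtain ⟨N, hN⟩ : ∃ N, ∀ s ∈ S, ∀ m, ddist s (x m) ≠ ⊤ → ddist s (x N) ≠ ⊤ := by
    induction S, hS using Set.Finite.induction_on with
    | empty => exact ⟨0, by simp⟩
    | @insert a S _ _ ih =>
      obtain ⟨N, hN⟩ := ih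
      by_cases ha : ∃ m, ddist a (x m) ≠ ⊤
      · obtain ⟨m, hm⟩ := ha
        refine ⟨max N m, ?_⟩
        rintro s (rfl | hs) l hl
        · exact mono (le_max_right _ _) hm
        · exact mono (le_max_left _ _) (hN s hs l hl)
      · push Not at ha
        refine ⟨N, ?_⟩
        rintro s (rfl | hs) l hl
        · exact absurd (ha l) hl
        · exact hN s hs l hl
  obtain ⟨n, hn⟩ := hno N
  obtain ⟨j, hj⟩ := hyx n
  obtain ⟨m, hm⟩ := hxy j
  obtain ⟨p, hp⟩ := exists_isGeodesic hj
  refine ⟨_, ⟨n, rfl⟩, _, ⟨j, rfl⟩, p, fun v hv hvS => ?_⟩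
  have hb := hp.between hv
  exact ddist_ne_top_trans hb.left_ne_top
    (hN v hvS m (ddist_ne_top_trans hb.right_ne_top hm)) hn

/-- Every ray in a hyperbolic digraph with finite out-degrees that satisfies the ball conditions
is equivalent to a geodesic ray. -/
theorem exists_equivalent_geodesic_ray (hyp : IsHyperbolic V) (hB1 : BoundedOutBalls V)
    (hB2 : BoundedInBalls V) (hfin : ∀ v : V, FiniteOutDegree v) {x : ℕ → V}
    (hx : Function.Injective x) (adj : ∀ i, Nonempty (x i ⟶ x (i + 1))) :
    ∃ y : ℕ → V, Function.Injective y ∧ (∀ i, Nonempty (y i ⟶ y (i + 1))) ∧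
      (∀ i j, i ≤ j → ddist (y i) (y j) = ((j - i : ℕ) : ℕ∞)) ∧
      NotFinitelySeparated (Set.range x) (Set.range y) ∧
      NotFinitelySeparated (Set.range y) (Set.range x) := by
  have mono : ∀ {m n}, m ≤ n → ddist (x m) (x n) ≠ ⊤ := fun hmn => by
    obtain ⟨w, -, -⟩ := exists_path_along adj hmn
    exact ddist_ne_top w
  by_cases hno : ∀ N, ∃ n, ddist (x n) (x N) = ⊤
  · obtain ⟨y, h0, adjy, hy, hxy⟩ := exists_geodesic_ray hfin hx fun m => mono (Nat.zero_le m)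
    rw [← h0] at hy hxy
    refine ⟨y, injective_of_ddist hy, adjy, fun i j => ddist_eq_sub adjy hy, ?_,
      notFinitelySeparated_of_between hy hxy⟩
    refine notFinitelySeparated_of_no_return (fun j => ?_) adj (fun n => ?_) hno
    · obtain ⟨m, hm⟩ := (hxy j).nonempty
      exact ⟨m, Between.right_ne_top hm⟩
    · exact exists_ddist_ne_top hyp hB2 adj adjy hy hxy n (h0 ▸ mono (Nat.zero_le n))
  -- All of `x` reaches `x N`, so the tail from `x N` satisfies the return condition.
  · push Not at hno
    obtain ⟨N, hN⟩ := hno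
    obtain ⟨y, h0, adjy, hy, hxy⟩ := exists_geodesic_ray hfin
      (hx.comp (add_right_injective N)) (o := x N) fun m => mono (Nat.le_add_right N m)
    rw [← h0] at hy hxy
    have hsub : Set.range (x ∘ fun m => N + m) ⊆ Set.range x := Set.range_comp_subset_range _ _
    exact ⟨y, injective_of_ddist hy, adjy, fun i j => ddist_eq_sub adjy hy,
      (notFinitelySeparated_of_return hyp hB1 adjy hy hxy fun m => h0 ▸ hN _).mono hsub subset_rfl,
      (notFinitelySeparated_of_between hy hxy).mono subset_rfl hsub⟩

open Opposite in
/-- Every anti-ray in a hyperbolic digraph with finite in-degrees that satisfies the ball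
conditions is equivalent to a geodesic anti-ray. -/
theorem exists_equivalent_geodesic_antiRay (hyp : IsHyperbolic V) (hB1 : BoundedOutBalls V)
    (hB2 : BoundedInBalls V) (hfin : ∀ v : V, FiniteInDegree v) {x : ℕ → V}
    (hx : Function.Injective x) (adj : ∀ i, Nonempty (x (i + 1) ⟶ x i)) :
    ∃ y : ℕ → V, Function.Injective y ∧ (∀ i, Nonempty (y (i + 1) ⟶ y i)) ∧
      (∀ i j, i ≤ j → ddist (y j) (y i) = ((j - i : ℕ) : ℕ∞)) ∧
      NotFinitelySeparated (Set.range x) (Set.range y) ∧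
      NotFinitelySeparated (Set.range y) (Set.range x) := by
  obtain ⟨y, hy, adjy, hgeo, h1, h2⟩ := exists_equivalent_geodesic_ray hyp.op hB2.op hB1.op
    (fun v => (hfin v.unop).op) (op_injective.comp hx) fun i => (adj i).map Quiver.Hom.op
  refine ⟨fun i => (y i).unop, unop_injective.comp hy, fun i => (adjy i).map Quiver.Hom.unop,
    fun i j hij => (ddist_unop _ _).trans (hgeo i j hij), ?_, ?_⟩
  · rw [← notFinitelySeparated_op, unop_preimage_range, unop_preimage_range]
    exact h2
  · rw [← notFinitelySeparated_op, unop_preimage_range, unop_preimage_range]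
    exact h1

end GeodesicRays


/-! ### Refinement of classes and the comparison of the two orders -/

/-- Reflexivity puts `a` into its own class, so a coarse class containing that class contains `a`
and is determined by it through transitivity of `le'`. -/
theorem isRefinement_classesOn {α : Type*} {s t : Set α} {le le' : α → α → Prop} (hst : s ⊆ t)
    (hrefl : ∀ a ∈ s, le a a) (hle : ∀ a b, le a b → le' a b)
    (htrans' : ∀ a b c, le' a b → le' b c → le' a c)
    (hex : ∀ b ∈ t, ∃ a ∈ s, le' a b ∧ le' b a) :
    IsRefinement (classesOn s le) (classesOn t le') := by
  constructor
  · rintro _ ⟨a, ha, rfl⟩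
    refine ⟨{b | b ∈ t ∧ le' a b ∧ le' b a}, ⟨⟨a, hst ha, rfl⟩,
      fun b hb => ⟨hst hb.1, hle _ _ hb.2.1, hle _ _ hb.2.2⟩⟩, ?_⟩
    rintro _ ⟨⟨c, -, rfl⟩, hsub⟩
    obtain ⟨-, hca, hac⟩ := hsub ⟨ha, hrefl a ha, hrefl a ha⟩
    ext b
    exact and_congr_right fun _ =>
      ⟨fun h => ⟨htrans' _ _ _ hac h.1, htrans' _ _ _ h.2 hca⟩,
        fun h => ⟨htrans' _ _ _ hca h.1, htrans' _ _ _ h.2 hac⟩⟩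
  · rintro _ ⟨b, hb, rfl⟩
    obtain ⟨a, ha, hab, hba⟩ := hex b hb
    exact ⟨_, ⟨a, ha, rfl⟩, fun c hc => ⟨hst hc.1, htrans' _ _ _ hba (hle _ _ hc.2.1),
      htrans' _ _ _ (hle _ _ hc.2.2) hab⟩⟩

namespace OneWayPath

variable {V : Type*} [Quiver V]

theorem EndLE.trans {R₁ R₂ R₃ : OneWayPath V} (h : R₁.EndLE R₂) (h' : R₂.EndLE R₃) :
    R₁.EndLE R₃ := by
  rw [EndLE, infinitelyManyDisjointPaths_iff] at h h' ⊢
  cases R₂ with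
  | ray x inj adj => exact h.trans_ray inj adj h'
  | antiRay x inj adj => exact h.trans_antiRay inj adj h'

/-- Finitely many vertices that can be reached from `R` can all be reached from one vertex
of `R`. -/
theorem exists_common_source (R : OneWayPath V) {S : Set V} (hS : S.Finite) :
    ∃ z, ∀ s ∈ S, ∀ a ∈ R.support, ddist a s ≠ ⊤ → ddist z s ≠ ⊤ := by
  cases R with
  | ray x inj adj =>
    refine ⟨x 0, ?_⟩
    rintro s - _ ⟨i, rfl⟩ h
    obtain ⟨p, -, -⟩ := exists_path_along adj (Nat.zero_le i)
    exact ddist_ne_top_trans (ddist_ne_top p) h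
  | antiRay x inj adj =>
    have mono : ∀ {m n}, m ≤ n → ddist (x n) (x m) ≠ ⊤ := by
      intro m n hmn
      induction n, hmn using Nat.le_induction with
      | base => simp [ddist_self]
      | succ n _ ih =>
        obtain ⟨e⟩ := adj n
        exact ddist_ne_top_trans (ddist_ne_top e.toPath) ih
    -- An anti-ray has no first vertex, but a vertex far enough back reaches all of the finitely
    -- many targets.
    have hN : ∀ s : V, ∃ N, ∀ i, ddist (x i) s ≠ ⊤ → ddist (x N) s ≠ ⊤ := fun s => by
      by_cases h : ∃ i, ddist (x i) s ≠ ⊤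
      · obtain ⟨i, hi⟩ := h
        exact ⟨i, fun _ _ => hi⟩
      · exact ⟨0, fun i hi => absurd ⟨i, hi⟩ h⟩
    choose N hN using hN
    obtain ⟨M, hM⟩ := (hS.image N).bddAbove
    refine ⟨x M, ?_⟩
    rintro s hs _ ⟨i, rfl⟩ h
    exact ddist_ne_top_trans (mono (hM ⟨s, hs, rfl⟩)) (hN s i h)

/-- The part of `S` reachable from `R₁` lies in one out-ball around a common source `z`. A path from
`R₁` avoiding that ball avoids `S`, since it contains only vertices reachable from `R₁`. -/
theorem GeodLE.endLE {R₁ R₂ : OneWayPath V} (h : R₁.GeodLE R₂) : R₁.EndLE R₂ := by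
  refine infinitelyManyDisjointPaths_iff.2 fun S hS => ?_
  obtain ⟨M, hM⟩ := h
  obtain ⟨z, hz⟩ := R₁.exists_common_source hS
  obtain ⟨k, hk⟩ := exists_bound_of_finite hS (ddist z)
  obtain ⟨a, ha, b, hb, p, -, hp⟩ := hM k z
  refine ⟨a, ha, b, hb, p, fun v hv hvS => hp v hv (.inl ?_)⟩
  obtain ⟨q, -, -⟩ := p.exists_eq_comp_of_mem_vertices hv
  exact toENNReal_le_natCast (hk v hvS (hz v hvS a ha (ddist_ne_top q)))

theorem exists_notMem_ball (hB1 : BoundedOutBalls V) (hB2 : BoundedInBalls V) {y : ℕ → V}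
    (hy : (∀ i j, i ≤ j → ddist (y i) (y j) = ((j - i : ℕ) : ℕ∞)) ∨
      ∀ i j, i ≤ j → ddist (y j) (y i) = ((j - i : ℕ) : ℕ∞)) (x : V) (r : ℝ≥0) :
    ∃ i, y i ∉ outBall x r ∪ inBall x r := by
  obtain ⟨f, hf⟩ := hB1.exists_nat
  obtain ⟨g, hg⟩ := hB2.exists_nat
  obtain ⟨F, hF⟩ : ∃ F, F = max (f ⌈r⌉₊) (g ⌈r⌉₊) := ⟨_, rfl⟩
  have hfF : f ⌈r⌉₊ ≤ F := hF ▸ le_max_left _ _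
  have hgF : g ⌈r⌉₊ ≤ F := hF ▸ le_max_right _ _
  have hout : ∀ i j, i ≤ j → y i ∈ outBall x r → y j ∈ outBall x r → j - i ≤ F := by
    intro i j hij hi hj
    have hi := le_ceil_of_toENNReal_le hi
    have hj := le_ceil_of_toENNReal_le hj
    rcases hy with hy | hy
    · have := hf x _ _ _ hi hj (by rw [hy i j hij]; exact ENat.natCast_ne_top _)
      rw [hy i j hij] at this
      exact (Nat.cast_le.1 this).trans hfF
    · have := hf x _ _ _ hj hi (by rw [hy i j hij]; exact ENat.natCast_ne_top _)
      rw [hy i j hij] at this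
      exact (Nat.cast_le.1 this).trans hfF
  have hin : ∀ i j, i ≤ j → y i ∈ inBall x r → y j ∈ inBall x r → j - i ≤ F := by
    intro i j hij hi hj
    have hi := le_ceil_of_toENNReal_le hi
    have hj := le_ceil_of_toENNReal_le hj
    rcases hy with hy | hy
    · have := hg x _ _ _ hi hj (by rw [hy i j hij]; exact ENat.natCast_ne_top _)
      rw [hy i j hij] at this
      exact (Nat.cast_le.1 this).trans hgF
    · have := hg x _ _ _ hj hi (by rw [hy i j hij]; exact ENat.natCast_ne_top _)
      rw [hy i j hij] at this
      exact (Nat.cast_le.1 this).trans hgF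
  by_contra! h
  have far : ∀ i j, i + F < j → ¬ (j - i ≤ F) := fun i j hij => by omega
  -- Of three vertices pairwise more than `F` apart, two would lie in the same one of the two balls.
  have h01 := far 0 (F + 1) (by omega)
  have h02 := far 0 (2 * F + 2) (by omega)
  have h12 := far (F + 1) (2 * F + 2) (by omega)
  rcases h 0 with h0 | h0 <;> rcases h (F + 1) with h1 | h1
  · exact h01 (hout _ _ (by omega) h0 h1)
  · rcases h (2 * F + 2) with h2 | h2
    · exact h02 (hout _ _ (by omega) h0 h2)
    · exact h12 (hin _ _ (by omega) h1 h2)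
  · rcases h (2 * F + 2) with h2 | h2
    · exact h12 (hout _ _ (by omega) h1 h2)
    · exact h02 (hin _ _ (by omega) h0 h2)
  · exact h01 (hin _ _ (by omega) h0 h1)

/-- A single vertex outside the balls is a path of length zero, so `M = 0` suffices. -/
theorem IsGeodesic.geodLE_refl (hB1 : BoundedOutBalls V) (hB2 : BoundedInBalls V)
    {R : OneWayPath V} (h : R.IsGeodesic) : R.GeodLE R := by
  refine ⟨0, fun r x => ?_⟩
  have key : ∃ v ∈ R.support, v ∉ outBall x r ∪ inBall x r := by
    cases R with
    | ray y _ _ =>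
      obtain ⟨i, hi⟩ := exists_notMem_ball hB1 hB2 (.inl h) x r
      exact ⟨_, ⟨i, rfl⟩, hi⟩
    | antiRay y _ _ =>
      obtain ⟨i, hi⟩ := exists_notMem_ball hB1 hB2 (.inr h) x r
      exact ⟨_, ⟨i, rfl⟩, hi⟩
  obtain ⟨v, hv, hvb⟩ := key
  exact ⟨v, hv, v, hv, .nil, by simp, by simpa using hvb⟩

theorem exists_isGeodesic_of_isRay (hyp : IsHyperbolic V) (hB1 : BoundedOutBalls V)
    (hB2 : BoundedInBalls V) (hfin : ∀ v : V, FiniteOutDegree v) {R : OneWayPath V}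
    (hR : R.IsRay) :
    ∃ R' : OneWayPath V, R'.IsRay ∧ R'.IsGeodesic ∧ R'.EndLE R ∧ R.EndLE R' := by
  cases R with
  | ray x inj adj =>
    obtain ⟨y, hy, adjy, hgeo, h1, h2⟩ :=
      exists_equivalent_geodesic_ray hyp hB1 hB2 hfin inj adj
    exact ⟨.ray y hy adjy, trivial, hgeo, infinitelyManyDisjointPaths_iff.2 h2,
      infinitelyManyDisjointPaths_iff.2 h1⟩
  | antiRay x inj adj => exact hR.elim

theorem exists_isGeodesic_of_isAntiRay (hyp : IsHyperbolic V) (hB1 : BoundedOutBalls V)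
    (hB2 : BoundedInBalls V) (hfin : ∀ v : V, FiniteInDegree v) {R : OneWayPath V}
    (hR : R.IsAntiRay) :
    ∃ R' : OneWayPath V, R'.IsAntiRay ∧ R'.IsGeodesic ∧ R'.EndLE R ∧ R.EndLE R' := by
  cases R with
  | ray x inj adj => exact hR.elim
  | antiRay x inj adj =>
    obtain ⟨y, hy, adjy, hgeo, h1, h2⟩ :=
      exists_equivalent_geodesic_antiRay hyp hB1 hB2 hfin inj adj
    exact ⟨.antiRay y hy adjy, trivial, hgeo, infinitelyManyDisjointPaths_iff.2 h2,
      infinitelyManyDisjointPaths_iff.2 h1⟩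

end OneWayPath

end DigraphBoundary

theorem mainTheorem5 {V : Type*} [Quiver V]
    (hyp : DigraphBoundary.IsHyperbolic V)
    (hB1 : DigraphBoundary.BoundedOutBalls V)
    (hB2 : DigraphBoundary.BoundedInBalls V) :
    ((∀ x : V, DigraphBoundary.FiniteOutDegree x) →
      DigraphBoundary.IsRefinement
        (DigraphBoundary.geodesicFBoundary V) (DigraphBoundary.fEnds V)) ∧
    ((∀ x : V, DigraphBoundary.FiniteInDegree x) →
      DigraphBoundary.IsRefinement
        (DigraphBoundary.geodesicBBoundary V) (DigraphBoundary.bEnds V)) ∧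
    ((∀ x : V, DigraphBoundary.FiniteOutDegree x ∧ DigraphBoundary.FiniteInDegree x) →
      DigraphBoundary.IsRefinement
        (DigraphBoundary.geodesicBoundary V) (DigraphBoundary.ends V)) := by
  open DigraphBoundary OneWayPath in
  refine ⟨fun hfin => ?_, fun hfin => ?_, fun hfin => ?_⟩
  · refine isRefinement_classesOn (fun R hR => hR.1) (fun R hR => hR.2.geodLE_refl hB1 hB2)
      (fun _ _ => GeodLE.endLE) (fun _ _ _ => EndLE.trans)
      fun R hR => ?_
    obtain ⟨R', h1, h2, h3⟩ := exists_isGeodesic_of_isRay hyp hB1 hB2 hfin hR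
    exact ⟨R', ⟨h1, h2⟩, h3⟩
  · refine isRefinement_classesOn (fun R hR => hR.1) (fun R hR => hR.2.geodLE_refl hB1 hB2)
      (fun _ _ => GeodLE.endLE) (fun _ _ _ => EndLE.trans)
      fun R hR => ?_
    obtain ⟨R', h1, h2, h3⟩ := exists_isGeodesic_of_isAntiRay hyp hB1 hB2 hfin hR
    exact ⟨R', ⟨h1, h2⟩, h3⟩
  · refine isRefinement_classesOn (Set.subset_univ _)
      (fun R hR => OneWayPath.IsGeodesic.geodLE_refl hB1 hB2 hR)
      (fun _ _ => GeodLE.endLE) (fun _ _ _ => EndLE.trans)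
      fun R _ => ?_
    cases R with
    | ray x inj adj =>
      obtain ⟨R', -, h2, h3⟩ := exists_isGeodesic_of_isRay hyp hB1 hB2 (fun v => (hfin v).1)
        (R := .ray x inj adj) trivial
      exact ⟨R', h2, h3⟩
    | antiRay x inj adj =>
      obtain ⟨R', -, h2, h3⟩ := exists_isGeodesic_of_isAntiRay hyp hB1 hB2
        (fun v => (hfin v).2) (R := .antiRay x inj adj) trivial
      exact ⟨R', h2, h3⟩
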